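/- For $u\in L^p(\mathbb{R})$, $1<p<\infty$, the Hilbert transform is $$\mathcal{H}[u](x)=\frac1\pi\lim_{\varepsilon\to0^+}\int_{|x-y|>\varepsilon}\frac{u(y)}{x-y}\,dy\qquad\text{(for almost every }x\in\mathbb{R}).$$ Let $T_n$ be the Chebyshev polynomials of the first kind. For $n\ge0$ put $V_n(x)=(1-x^2)^{-1/2}T_n(x)$ for $|x|<1$ and $V_n(x)=0$ for $|x|\ge1$, and put $\tilde T_n(x)=T_n(x)$ for $|x|\le1$ and $\tilde T_n(x)=\big(x-\operatorname{sgn}(x)\sqrt{x^2-1}\big)^n$ for $|x|>1$. Let $\tilde U_{-2}(x)=\tilde U_{-1}(x)=0$ for $|x|\le1$, and $\tilde U_{-2}(x)=-|x|/\sqrt{x^2-1}$, $\tilde U_{-1}(x)=-\operatorname{sgn}(x)/\sqrt{x^2-1}$ for $|x|>1$; let $\tilde U_0=\tilde T_0+\tilde U_{-2}$ and $\tilde U_n=2\tilde T_n+\tilde U_{n-2}$ for $n\ge1$. For an interval $I=[a,b]$ with $a<b$, put $\tilde U^I_n(x)=\tilde U_n(y)$ and $V^I_n(x)=V_n(y)$,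 where $y=\frac{2}{b-a}\big(x-\frac{a+b}{2}\big)$. Corollary. Let $I=[a,b]$ with $a<b$ and let $n\ge0$. Then $\tilde U^I_n$ and $V^I_{n+1}$ belong to $L^p(\mathbb{R})$ for all $p\in(1,2)$, and for every $x\in\mathbb{R}\setminus\{a,b\}$ (in particular for almost every $x\in\mathbb{R}$) the integrals over $|x-y|>\varepsilon$ converge absolutely for every $\varepsilon>0$, the principal values exist, and $$\mathcal{H}[\tilde U^I_n](x)=V^I_{n+1}(x)\qquad\text{and}\qquad\mathcal{H}[V^I_{n+1}](x)=-\tilde U^I_n(x).$$ -/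

import Mathlib

open MeasureTheory Filter Topology
open scoped ENNReal

namespace SumSpace

noncomputable section

/-- The truncated Hilbert integral of `u` at `x`, that is
`(1 / π) ∫_{|x - y| > ε} u(y) / (x - y) dy`. -/
def truncatedHilbert (u : ℝ → ℝ) (x ε : ℝ) : ℝ :=
  1 / Real.pi * ∫ y in {y : ℝ | ε < |x - y|}, u y / (x - y)

/-- The Hilbert transform of `u` exists at `x` and equals `h`: the truncated integrals converge
absolutely, and their limit as `ε → 0+` (the principal value) exists and is `h`. -/
def HasHilbertTransformAt (u : ℝ → ℝ) (h x : ℝ) : Prop :=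
  (∀ ε : ℝ, 0 < ε → IntegrableOn (fun y => u y / (x - y)) {y : ℝ | ε < |x - y|}) ∧
    Tendsto (fun ε => truncatedHilbert u x ε) (𝓝[>] 0) (𝓝 h)

/-- The extended Chebyshev functions of the first kind. -/
def extT (n : ℕ) (x : ℝ) : ℝ :=
  if |x| ≤ 1 then (Polynomial.Chebyshev.T ℝ (n : ℤ)).eval x
  else (x - Real.sign x * Real.sqrt (x ^ 2 - 1)) ^ n

/-- The extended Chebyshev function of the second kind of index `-2`. -/
def extUNegTwo (x : ℝ) : ℝ :=
  if |x| ≤ 1 then 0 else -(|x| / Real.sqrt (x ^ 2 - 1))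

/-- The extended Chebyshev function of the second kind of index `-1`. -/
def extUNegOne (x : ℝ) : ℝ :=
  if |x| ≤ 1 then 0 else -(Real.sign x / Real.sqrt (x ^ 2 - 1))

/-- The extended Chebyshev functions of the second kind of index `n ≥ 0`. -/
def extU : ℕ → ℝ → ℝ
  | 0, x => extT 0 x + extUNegTwo x
  | 1, x => 2 * extT 1 x + extUNegOne x
  | n + 2, x => 2 * extT (n + 2) x + extU n x

/-- The weight `(1 - x ^ 2)_+ ^ (-1/2)`, extended by zero to `|x| ≥ 1`. -/
def weight (x : ℝ) : ℝ :=
  if |x| < 1 then 1 / Real.sqrt (1 - x ^ 2) else 0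

/-- The weighted Chebyshev polynomials of the first kind, extended by zero. -/
def weightedT (n : ℕ) (x : ℝ) : ℝ :=
  weight x * (Polynomial.Chebyshev.T ℝ (n : ℤ)).eval x

/-- The affine map that takes the interval `[a, b]` to `[-1, 1]`. -/
def toRef (a b x : ℝ) : ℝ := 2 / (b - a) * (x - (a + b) / 2)

/-- The extended Chebyshev functions of the second kind centred at `[a, b]`. -/
def extUOn (a b : ℝ) (n : ℕ) (x : ℝ) : ℝ := extU n (toRef a b x)

/-- The weighted Chebyshev polynomials of the first kind centred at `[a, b]`. -/
def weightedTOn (a b : ℝ) (n : ℕ) (x : ℝ) : ℝ := weightedT n (toRef a b x)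

end

end SumSpace

/-!
The proof reduces to `[a, b] = [-1, 1]` by an affine change of variable and then argues by the
three-term recurrence `f (n + 2) = 2 * y * f (n + 1) - f n`, which both families satisfy on the
whole line. Since `y / (x - y) = x / (x - y) - 1`, the Hilbert transform of `y * u` at `x` is `x`
times that of `u`, minus `(∫ u) / π` (`HasHilbertTransformAt.id_mul`). All integrals that occur
vanish, except `∫ weight = π` in the first step, so the recurrence passes to the Hilbert
transforms.

It remains to start the recursions, that is, to find the Hilbert transforms of `weight` and of
`extUNegOne`, which are `-extUNegOne` and `weight`. These two functions are, up to sign, the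
derivatives of `arcsin`, clamped to be constant outside `[-1, 1]`, and of an even `arcosh`, clamped
to vanish inside. The Möbius map `mobius x`, `y ↦ (x y - 1) / (x - y)`, fixes `1` and `-1`, has its
pole at `x` and satisfies `mobius x y ^ 2 - 1 = (x ^ 2 - 1) * (y ^ 2 - 1) / (x - y) ^ 2`. Hence
`weight y / (x - y)` and `extUNegOne y / (x - y)` are, up to factors that depend on `x` only, the
derivatives of `arcsin ∘ mobius x` and `clampedArcosh ∘ mobius x`, in an order that depends on
whether `|x| < 1` or `1 < |x|`. These antiderivatives are continuous away from `x` and have equal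
limits at both ends of the line, so that the principal value is their jump across `x`
(`hasHilbertTransformAt_of_hasDerivAt`): `±π` for `arcsin ∘ mobius x` and `0` for `clampedArcosh ∘
mobius x`.

The function `extUNegOne` decays only like `1 / y` and is not integrable. The step from it to `extU
0` is therefore made separately, in `hasHilbertTransformAt_one_sub`. From then on the functions are
dominated by the integrable function `edgeDecay`. Membership in `L^p` for `1 < p < 2` follows from
that of `edge y = |y ^ 2 - 1| ^ (-1 / 2)`.
-/

namespace SumSpace

noncomputable section

/-! ### Principal values -/

theorem setOf_lt_abs_sub (x ε : ℝ) :
    {y : ℝ | ε < |x - y|} = Set.Iio (x - ε) ∪ Set.Ioi (x + ε) := by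
  ext y
  simp only [Set.mem_ofPred_eq, lt_abs, Set.mem_union, Set.mem_Iio, Set.mem_Ioi]
  constructor <;> rintro (h | h) <;> [left; right; left; right] <;> linarith

theorem measurableSet_lt_abs_sub (x ε : ℝ) : MeasurableSet {y : ℝ | ε < |x - y|} :=
  measurableSet_lt measurable_const (by fun_prop)

/-- The fundamental theorem of calculus on a right half-line, with countably many exceptional
points. -/
theorem integral_Ioi_of_hasDerivAt_off_countable {F f : ℝ → ℝ} {c L : ℝ} {s : Set ℝ}
    (hs : s.Countable) (hc : ContinuousOn F (Set.Ici c))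
    (hd : ∀ y ∈ Set.Ioi c \ s, HasDerivAt F (f y) y) (hf : IntegrableOn f (Set.Ioi c))
    (hL : Tendsto F atTop (𝓝 L)) : ∫ y in Set.Ioi c, f y = L - F c := by
  refine tendsto_nhds_unique (intervalIntegral_tendsto_integral_Ioi c hf tendsto_id) ?_
  refine (hL.sub_const (F c)).congr' ?_
  filter_upwards [eventually_ge_atTop c] with R hR
  refine (integral_eq_of_hasDerivAt_off_countable_of_le F f hR hs
    (hc.mono Set.Icc_subset_Ici_self) (fun y hy => hd y ⟨hy.1.1, hy.2⟩) ?_).symm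
  exact (intervalIntegrable_iff_integrableOn_Ioc_of_le hR).2 (hf.mono_set Set.Ioc_subset_Ioi_self)

/-- The fundamental theorem of calculus on a left half-line, with countably many exceptional
points. -/
theorem integral_Iio_of_hasDerivAt_off_countable {F f : ℝ → ℝ} {c L : ℝ} {s : Set ℝ}
    (hs : s.Countable) (hc : ContinuousOn F (Set.Iic c))
    (hd : ∀ y ∈ Set.Iio c \ s, HasDerivAt F (f y) y) (hf : IntegrableOn f (Set.Iio c))
    (hL : Tendsto F atBot (𝓝 L)) : ∫ y in Set.Iio c, f y = F c - L := by
  have hf' : IntegrableOn f (Set.Iic c) := integrableOn_Iic_iff_integrableOn_Iio (by simp) |>.2 hf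
  rw [← integral_Iic_eq_integral_Iio]
  refine tendsto_nhds_unique (intervalIntegral_tendsto_integral_Iic c hf' tendsto_id) ?_
  refine (hL.const_sub (F c)).congr' ?_
  filter_upwards [eventually_le_atBot c] with R hR
  refine (integral_eq_of_hasDerivAt_off_countable_of_le F f hR hs
    (hc.mono Set.Icc_subset_Iic_self) (fun y hy => hd y ⟨hy.1.2, hy.2⟩) ?_).symm
  exact (intervalIntegrable_iff_integrableOn_Ioc_of_le hR).2 (hf'.mono_set Set.Ioc_subset_Iic_self)

/-- An integrable function whose continuous antiderivative has the same limit at both ends of the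
line has integral zero. -/
theorem integral_eq_zero_of_hasDerivAt_off_countable {F f : ℝ → ℝ} {L : ℝ} {s : Set ℝ}
    (hs : s.Countable) (hc : Continuous F) (hd : ∀ y ∉ s, HasDerivAt F (f y) y)
    (hf : Integrable f) (hL : Tendsto F (Bornology.cobounded ℝ) (𝓝 L)) : ∫ y, f y = 0 := by
  rw [IsOrderBornology.cobounded_eq, tendsto_sup] at hL
  rw [← intervalIntegral.integral_Iio_add_Ici (b := 0) hf.integrableOn hf.integrableOn,
    integral_Ici_eq_integral_Ioi,
    integral_Iio_of_hasDerivAt_off_countable hs hc.continuousOn (fun y hy => hd y hy.2)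
      hf.integrableOn hL.1,
    integral_Ioi_of_hasDerivAt_off_countable hs hc.continuousOn (fun y hy => hd y hy.2)
      hf.integrableOn hL.2]
  ring

/-- If `u y / (x - y)` has an antiderivative `F`, continuous away from `x` and with the same limit
at both ends of the line, then only the boundary terms at `x ± ε` survive in the truncated
integrals, and their limit is the principal value. -/
theorem hasHilbertTransformAt_of_hasDerivAt {u F : ℝ → ℝ} {x h L : ℝ} {s : Set ℝ}
    (hs : s.Countable)
    (hint : ∀ ε : ℝ, 0 < ε → IntegrableOn (fun y => u y / (x - y)) {y : ℝ | ε < |x - y|})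
    (hc : ContinuousOn F {x}ᶜ) (hd : ∀ y, y ≠ x → y ∉ s → HasDerivAt F (u y / (x - y)) y)
    (hL : Tendsto F (Bornology.cobounded ℝ) (𝓝 L))
    (hh : Tendsto (fun ε => F (x - ε) - F (x + ε)) (𝓝[>] 0) (𝓝 (Real.pi * h))) :
    HasHilbertTransformAt u h x := by
  refine ⟨hint, ?_⟩
  rw [IsOrderBornology.cobounded_eq, tendsto_sup] at hL
  have key := hh.const_mul (1 / Real.pi)
  rw [show 1 / Real.pi * (Real.pi * h) = h by field_simp] at key
  refine key.congr' ?_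
  filter_upwards [self_mem_nhdsWithin] with ε hε
  have hε : 0 < ε := hε
  have hi := hint ε hε
  rw [truncatedHilbert]
  rw [setOf_lt_abs_sub] at hi ⊢
  rw [setIntegral_union _ measurableSet_Ioi hi.left_of_union hi.right_of_union,
    integral_Iio_of_hasDerivAt_off_countable hs (hc.mono _) _ hi.left_of_union hL.1,
    integral_Ioi_of_hasDerivAt_off_countable hs (hc.mono _) _ hi.right_of_union hL.2]
  · ring
  · intro y hy
    simp only [Set.mem_Ici] at hy
    simp only [Set.mem_compl_iff, Set.mem_singleton_iff]
    linarith
  · intro y hy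
    have := hy.1
    simp only [Set.mem_Ioi] at this
    exact hd y (by linarith) hy.2
  · intro y hy
    simp only [Set.mem_Iic] at hy
    simp only [Set.mem_compl_iff, Set.mem_singleton_iff]
    linarith
  · intro y hy
    have := hy.1
    simp only [Set.mem_Iio] at this
    exact hd y (by linarith) hy.2
  · refine Set.disjoint_left.2 fun y hy hy' => ?_
    simp only [Set.mem_Iio, Set.mem_Ioi] at hy hy'
    linarith

namespace HasHilbertTransformAt

variable {u v : ℝ → ℝ} {h k x : ℝ}

theorem add (hu : HasHilbertTransformAt u h x) (hv : HasHilbertTransformAt v k x) :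
    HasHilbertTransformAt (fun y => u y + v y) (h + k) x := by
  refine ⟨fun ε hε => ?_, (hu.2.add hv.2).congr' ?_⟩
  · simp only [add_div]
    exact (hu.1 ε hε).add (hv.1 ε hε)
  · filter_upwards [self_mem_nhdsWithin] with ε hε
    simp only [truncatedHilbert, add_div]
    rw [integral_add (hu.1 ε hε) (hv.1 ε hε)]
    ring

theorem const_mul (c : ℝ) (hu : HasHilbertTransformAt u h x) :
    HasHilbertTransformAt (fun y => c * u y) (c * h) x := by
  refine ⟨fun ε hε => ?_, (hu.2.const_mul c).congr fun ε => ?_⟩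
  · simp only [mul_div_assoc]
    exact (hu.1 ε hε).const_mul c
  · simp only [truncatedHilbert, mul_div_assoc]
    rw [integral_const_mul]
    ring

theorem sub (hu : HasHilbertTransformAt u h x) (hv : HasHilbertTransformAt v k x) :
    HasHilbertTransformAt (fun y => u y - v y) (h - k) x := by
  have := hu.add (hv.const_mul (-1))
  simpa [sub_eq_add_neg] using this

/-- Multiplication by the variable commutes with the Hilbert transform up to a constant, because
`y / (x - y) = x / (x - y) - 1`. -/
theorem id_mul (hu : HasHilbertTransformAt u h x) (hi : Integrable u) :
    HasHilbertTransformAt (fun y => y * u y) (x * h - 1 / Real.pi * ∫ y, u y) x := by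
  have key : ∀ ε : ℝ, 0 < ε → ∀ y ∈ {y : ℝ | ε < |x - y|},
      x * (u y / (x - y)) - u y = y * u y / (x - y) := by
    intro ε hε y hy
    have : x - y ≠ 0 := by
      intro h0
      simp only [Set.mem_ofPred_eq, h0, abs_zero] at hy
      linarith
    field_simp
    ring
  refine ⟨fun ε hε => ?_, ?_⟩
  · exact IntegrableOn.congr_fun (((hu.1 ε hε).const_mul x).sub hi.integrableOn) (key ε hε)
      (measurableSet_lt_abs_sub x ε)
  have hlim : Tendsto (fun ε : ℝ => ∫ y in {y : ℝ | ε < |x - y|}, u y) (𝓝[>] 0)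
      (𝓝 (∫ y, u y)) := by
    simp only [← integral_indicator (measurableSet_lt_abs_sub x _)]
    refine tendsto_integral_filter_of_dominated_convergence (fun y => ‖u y‖)
      (Eventually.of_forall fun ε =>
        hi.aestronglyMeasurable.indicator (measurableSet_lt_abs_sub x ε))
      (Eventually.of_forall fun ε => Eventually.of_forall fun y => norm_indicator_le_norm_self u y)
      hi.norm ?_
    filter_upwards [compl_mem_ae_iff.2 (measure_singleton x)] with y hy
    have hpos : 0 < |x - y| := abs_pos.2 (sub_ne_zero.2 fun h0 => hy h0.symm)
    refine tendsto_const_nhds.congr' ?_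
    filter_upwards [mem_nhdsWithin_of_mem_nhds (Iio_mem_nhds hpos)] with ε hε
    exact (Set.indicator_of_mem (s := {y : ℝ | ε < |x - y|}) hε u).symm
  refine ((hu.2.const_mul x).sub (hlim.const_mul (1 / Real.pi))).congr' ?_
  filter_upwards [self_mem_nhdsWithin] with ε hε
  simp only [truncatedHilbert]
  rw [← setIntegral_congr_fun (measurableSet_lt_abs_sub x ε) (key ε hε),
    integral_sub ((hu.1 ε hε).const_mul x) hi.integrableOn, integral_const_mul]
  ring

/-- One step of the three-term recurrence of the Chebyshev polynomials. -/
theorem chebyshev_step (hu : HasHilbertTransformAt u h x) (hv : HasHilbertTransformAt v k x)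
    (hi : Integrable u) (h0 : ∫ y, u y = 0) :
    HasHilbertTransformAt (fun y => 2 * y * u y - v y) (2 * x * h - k) x := by
  have := ((hu.id_mul hi).const_mul 2).sub hv
  simpa [h0, mul_assoc] using this

end HasHilbertTransformAt

/-! ### Affine changes of variable -/

theorem toRef_sub (a b x y : ℝ) : toRef a b x - toRef a b y = 2 / (b - a) * (x - y) := by
  simp only [toRef]
  ring

theorem integrable_comp_toRef {a b : ℝ} (hab : a < b) {f : ℝ → ℝ} (hf : Integrable f) :
    Integrable (fun y => f (toRef a b y)) :=
  (hf.comp_mul_left' (R := 2 / (b - a))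
    (div_ne_zero two_ne_zero (sub_pos.2 hab).ne')).comp_sub_right ((a + b) / 2)

theorem integral_comp_toRef {a b : ℝ} (hab : a < b) (f : ℝ → ℝ) :
    ∫ y, f (toRef a b y) = (2 / (b - a))⁻¹ * ∫ y, f y := by
  have hc : 0 < 2 / (b - a) := div_pos two_pos (sub_pos.2 hab)
  have h1 := integral_sub_right_eq_self (μ := volume) (fun y => f (2 / (b - a) * y)) ((a + b) / 2)
  have h2 := Measure.integral_comp_mul_left f (2 / (b - a))
  simp only [toRef]
  rw [h1, h2, abs_of_pos (inv_pos.2 hc), smul_eq_mul]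

/-- The Hilbert transform commutes with increasing affine maps. -/
theorem HasHilbertTransformAt.comp_toRef {a b : ℝ} (hab : a < b) {u : ℝ → ℝ} {h x : ℝ}
    (hu : HasHilbertTransformAt u h (toRef a b x)) :
    HasHilbertTransformAt (fun y => u (toRef a b y)) h x := by
  set c := 2 / (b - a) with hc_def
  have hc : 0 < c := div_pos two_pos (sub_pos.2 hab)
  have key : ∀ ε : ℝ, Set.indicator {y : ℝ | ε < |x - y|} (fun y => u (toRef a b y) / (x - y)) =
      fun y => c * Set.indicator {y : ℝ | c * ε < |toRef a b x - y|}
        (fun y => u y / (toRef a b x - y)) (toRef a b y) := by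
    intro ε
    ext y
    have hmem : (c * ε < |toRef a b x - toRef a b y|) ↔ ε < |x - y| := by
      rw [toRef_sub, abs_mul, abs_of_pos hc, mul_lt_mul_iff_right₀ hc]
    by_cases hy : ε < |x - y|
    · rw [Set.indicator_of_mem (by exact hy), Set.indicator_of_mem (by exact hmem.2 hy), toRef_sub,
        ← hc_def]
      field_simp
    · rw [Set.indicator_of_notMem (by exact hy),
        Set.indicator_of_notMem (by exact fun h => hy (hmem.1 h)), mul_zero]
  refine ⟨fun ε hε => ?_, ?_⟩
  · rw [← integrable_indicator_iff (measurableSet_lt_abs_sub x ε), key]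
    exact (integrable_comp_toRef hab ((integrable_indicator_iff
      (measurableSet_lt_abs_sub _ _)).2 (hu.1 (c * ε) (mul_pos hc hε)))).const_mul c
  · have hlim : Tendsto (fun ε : ℝ => c * ε) (𝓝[>] 0) (𝓝[>] 0) := by
      refine tendsto_nhdsWithin_iff.2 ⟨?_, ?_⟩
      · have : Tendsto (fun ε : ℝ => c * ε) (𝓝 0) (𝓝 (c * 0)) :=
          (continuous_const_mul c).tendsto 0
        rw [mul_zero] at this
        exact this.mono_left nhdsWithin_le_nhds
      · filter_upwards [self_mem_nhdsWithin] with ε hε using mul_pos hc hε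
    refine (hu.2.comp hlim).congr fun ε => ?_
    simp only [Function.comp_apply, truncatedHilbert]
    rw [← integral_indicator (measurableSet_lt_abs_sub x ε), key, integral_const_mul,
      integral_comp_toRef hab, integral_indicator (measurableSet_lt_abs_sub _ _), ← hc_def,
      mul_inv_cancel_left₀ hc.ne']

theorem memLp_comp_toRef {a b : ℝ} (hab : a < b) {u : ℝ → ℝ} {p : ℝ≥0∞} (h0 : p ≠ 0) (ht : p ≠ ⊤)
    (hm : Measurable u) (hu : MemLp u p volume) :
    MemLp (fun y => u (toRef a b y)) p volume := by
  have hm' : Measurable (fun y => u (toRef a b y)) := hm.comp (by unfold toRef; fun_prop)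
  rw [← integrable_norm_rpow_iff hm.aestronglyMeasurable h0 ht] at hu
  rw [← integrable_norm_rpow_iff hm'.aestronglyMeasurable h0 ht]
  exact integrable_comp_toRef hab hu

/-! ### The clamped inverse hyperbolic cosine -/

/-- The inverse hyperbolic cosine of `max 1 |t|`: the even extension of `Real.arcosh` that vanishes
on `[-1, 1]`. It is the counterpart of `Real.arcsin`, which Mathlib extends by constants outside
`[-1, 1]`. -/
def clampedArcosh (t : ℝ) : ℝ := Real.arcosh (max 1 |t|)

theorem continuous_clampedArcosh : Continuous clampedArcosh :=
  Real.continuousOn_arcosh.comp_continuous (by fun_prop) fun t => le_max_left 1 |t|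

theorem clampedArcosh_neg (t : ℝ) : clampedArcosh (-t) = clampedArcosh t := by
  simp [clampedArcosh]

/-- Differentiability holds outside `[-1, 1]` too, because `Real.arcsin` is constant there. -/
theorem hasDerivAt_arcsin_weight {t : ℝ} (h1 : t ≠ 1) (h2 : t ≠ -1) :
    HasDerivAt Real.arcsin (weight t) t := by
  by_cases ht : |t| < 1
  · rw [weight, if_pos ht]
    exact Real.hasDerivAt_arcsin h2 h1
  · rw [weight, if_neg ht]
    rcases le_abs.1 (not_lt.1 ht) with h | h
    · refine (hasDerivAt_const t (Real.pi / 2)).congr_of_eventuallyEq ?_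
      filter_upwards [Ioi_mem_nhds (lt_of_le_of_ne h h1.symm)] with y hy
        using Real.arcsin_of_one_le (le_of_lt hy)
    · refine (hasDerivAt_const t (-(Real.pi / 2))).congr_of_eventuallyEq ?_
      filter_upwards [Iio_mem_nhds (lt_of_le_of_ne (show t ≤ -1 by linarith) h2)] with y hy
        using Real.arcsin_of_le_neg_one (le_of_lt hy)

theorem hasDerivAt_clampedArcosh {t : ℝ} (h1 : t ≠ 1) (h2 : t ≠ -1) :
    HasDerivAt clampedArcosh (-extUNegOne t) t := by
  have key : ∀ r : ℝ, 1 < r → HasDerivAt clampedArcosh (-extUNegOne r) r := by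
    intro r hr
    have hr' : ¬ |r| ≤ 1 := not_le.2 (hr.trans_le (le_abs_self r))
    rw [extUNegOne, if_neg hr', Real.sign_of_pos (by linarith), neg_neg, one_div]
    refine (Real.hasDerivAt_arcosh hr).congr_of_eventuallyEq ?_
    filter_upwards [Ioi_mem_nhds hr] with y hy
    have hy : 1 < y := hy
    rw [clampedArcosh, abs_of_pos (by linarith), max_eq_right hy.le]
  rcases lt_or_ge (|t|) 1 with ht | ht
  · rw [extUNegOne, if_pos ht.le, neg_zero]
    refine (hasDerivAt_const t (Real.arcosh 1)).congr_of_eventuallyEq ?_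
    filter_upwards [(isOpen_lt continuous_abs continuous_const).mem_nhds ht] with y hy
    have hy : |y| < 1 := hy
    rw [clampedArcosh, max_eq_left hy.le]
  rcases le_abs.1 ht with h | h
  · exact key t (lt_of_le_of_ne h h1.symm)
  · have hr : 1 < -t := lt_of_le_of_ne h fun h' => h2 (by linarith)
    have hd := (key (-t) hr).scomp t (hasDerivAt_neg t)
    have hodd : extUNegOne (-t) = -extUNegOne t := by
      have hr' : ¬ |t| ≤ 1 := not_le.2 (hr.trans_le (neg_le_abs t))
      rw [extUNegOne, extUNegOne, abs_neg, if_neg hr', if_neg hr', Real.sign_neg, neg_sq]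
      ring
    rw [hodd] at hd
    have hfun : clampedArcosh ∘ Neg.neg = clampedArcosh := funext clampedArcosh_neg
    simpa [hfun] using hd

/-! ### Asymptotics -/

theorem tendsto_add_const_cobounded (c : ℝ) :
    Tendsto (fun t : ℝ => t + c) (Bornology.cobounded ℝ) (Bornology.cobounded ℝ) := by
  simp only [IsOrderBornology.cobounded_eq]
  exact (tendsto_atBot_add_const_right _ c tendsto_id).sup_sup
    (tendsto_atTop_add_const_right _ c tendsto_id)

theorem tendsto_log_add_const_sub_log (c : ℝ) :
    Tendsto (fun t : ℝ => Real.log (t + c) - Real.log t) (Bornology.cobounded ℝ) (𝓝 0) := by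
  have h : Tendsto (fun t : ℝ => Real.log (1 + c * t⁻¹)) (Bornology.cobounded ℝ) (𝓝 0) := by
    have h1 : ContinuousAt (fun z : ℝ => Real.log (1 + c * z)) 0 :=
      ContinuousAt.log (by fun_prop) (by simp)
    simpa using! h1.tendsto.comp (tendsto_inv₀_cobounded (α := ℝ))
  refine h.congr' ?_
  filter_upwards [Bornology.eventually_ne_cobounded 0,
    Bornology.eventually_ne_cobounded (-c)] with t h0 hc
  rw [← Real.log_div (fun h => hc (by linarith)) h0]
  congr 1
  field_simp

theorem tendsto_clampedArcosh_sub_log :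
    Tendsto (fun t : ℝ => clampedArcosh t - Real.log t) (Bornology.cobounded ℝ)
      (𝓝 (Real.log 2)) := by
  have h : Tendsto (fun t : ℝ => Real.log (1 + √(1 - t⁻¹ ^ 2))) (Bornology.cobounded ℝ)
      (𝓝 (Real.log 2)) := by
    have h1 : ContinuousAt (fun z : ℝ => Real.log (1 + √(1 - z ^ 2))) 0 :=
      ContinuousAt.log (by fun_prop) (by simp)
    have h2 := h1.tendsto.comp (tendsto_inv₀_cobounded (α := ℝ))
    norm_num at h2
    simpa [Function.comp_def] using! h2
  refine h.congr' ?_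
  have hev : ∀ᶠ t : ℝ in Bornology.cobounded ℝ, 1 < |t| :=
    (tendsto_norm_cobounded_atTop (E := ℝ)).eventually_gt_atTop 1
  filter_upwards [hev] with t ht
  have ht0 : 0 < |t| := by linarith
  rw [clampedArcosh, max_eq_right ht.le, Real.arcosh, ← Real.log_abs t,
    ← Real.log_div (by positivity) ht0.ne']
  congr 1
  have hs : √(|t| ^ 2 - 1) = |t| * √(1 - t⁻¹ ^ 2) := by
    rw [← Real.sqrt_sq ht0.le, ← Real.sqrt_mul (sq_nonneg _), Real.sqrt_sq ht0.le, sq_abs]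
    have : t ≠ 0 := abs_pos.1 ht0
    congr 1
    field_simp
  rw [hs]
  field_simp

theorem tendsto_clampedArcosh_add_const_sub (c : ℝ) :
    Tendsto (fun t : ℝ => clampedArcosh (t + c) - clampedArcosh t) (Bornology.cobounded ℝ)
      (𝓝 0) := by
  have h := ((tendsto_clampedArcosh_sub_log.comp (tendsto_add_const_cobounded c)).sub
    tendsto_clampedArcosh_sub_log).add (tendsto_log_add_const_sub_log c)
  rw [sub_self, zero_add] at h
  refine h.congr fun t => ?_
  simp only [Function.comp_apply]
  ring

/-! ### The Möbius substitution -/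

/-- The Möbius map `y ↦ (x y - 1) / (x - y)`, written so that its behaviour at `y = x` and at
infinity is visible. It sends `1` and `-1` to themselves. -/
def mobius (x y : ℝ) : ℝ := (x ^ 2 - 1) / (x - y) - x

/-- The reciprocal square root of `|y ^ 2 - 1|`. -/
def edge (y : ℝ) : ℝ := 1 / √|y ^ 2 - 1|

theorem edge_nonneg (y : ℝ) : 0 ≤ edge y := by
  unfold edge
  positivity

theorem weight_of_abs_lt {y : ℝ} (hy : |y| < 1) : weight y = edge y := by
  have : y ^ 2 < 1 := (sq_lt_one_iff_abs_lt_one y).2 hy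
  rw [weight, if_pos hy, edge, abs_of_neg (by linarith), neg_sub]

theorem weight_of_le_abs {y : ℝ} (hy : 1 ≤ |y|) : weight y = 0 := by
  rw [weight, if_neg (not_lt.2 hy)]

theorem extUNegOne_of_abs_le {y : ℝ} (hy : |y| ≤ 1) : extUNegOne y = 0 := by
  rw [extUNegOne, if_pos hy]

theorem extUNegOne_of_lt_abs {y : ℝ} (hy : 1 < |y|) : extUNegOne y = -(Real.sign y * edge y) := by
  have : 1 < y ^ 2 := (one_lt_sq_iff_one_lt_abs y).2 hy
  rw [extUNegOne, if_neg (not_le.2 hy), edge, abs_of_pos (by linarith)]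
  ring

theorem edge_sq_mul {y : ℝ} (h1 : y ≠ 1) (h2 : y ≠ -1) : edge y ^ 2 * |y ^ 2 - 1| = 1 := by
  have : 0 < |y ^ 2 - 1| := abs_pos.2 (sub_ne_zero.2 (by simp [sq_eq_one_iff, h1, h2]))
  rw [edge, div_pow, Real.sq_sqrt this.le]
  field_simp

theorem mobius_eq {x y : ℝ} (hy : y ≠ x) : mobius x y = (x * y - 1) / (x - y) := by
  have : x - y ≠ 0 := sub_ne_zero.2 hy.symm
  rw [mobius]
  field_simp
  ring

theorem mobius_sq_sub_one {x y : ℝ} (hy : y ≠ x) :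
    mobius x y ^ 2 - 1 = (x ^ 2 - 1) * (y ^ 2 - 1) / (x - y) ^ 2 := by
  have : x - y ≠ 0 := sub_ne_zero.2 hy.symm
  rw [mobius_eq hy]
  field_simp
  ring

theorem edge_mobius {x y : ℝ} (hy : y ≠ x) : edge (mobius x y) = |x - y| * edge x * edge y := by
  rw [edge, mobius_sq_sub_one hy, abs_div, abs_mul, Real.sqrt_div (by positivity),
    Real.sqrt_mul (abs_nonneg _), abs_of_nonneg (sq_nonneg (x - y)), Real.sqrt_sq_eq_abs, edge,
    edge]
  simp only [mul_inv, div_eq_mul_inv, inv_inv]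
  ring

theorem abs_mobius_lt_one_iff {x y : ℝ} (hy : y ≠ x) :
    |mobius x y| < 1 ↔ (x ^ 2 - 1) * (y ^ 2 - 1) < 0 := by
  have : 0 < (x - y) ^ 2 := by
    have := sub_ne_zero.2 hy.symm
    positivity
  rw [← sq_lt_one_iff_abs_lt_one, ← sub_neg, mobius_sq_sub_one hy, div_lt_iff₀ this, zero_mul]

theorem one_lt_abs_mobius_iff {x y : ℝ} (hy : y ≠ x) :
    1 < |mobius x y| ↔ 0 < (x ^ 2 - 1) * (y ^ 2 - 1) := by
  have : 0 < (x - y) ^ 2 := by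
    have := sub_ne_zero.2 hy.symm
    positivity
  rw [← one_lt_sq_iff_one_lt_abs, ← sub_pos, mobius_sq_sub_one hy, lt_div_iff₀ this, zero_mul]

theorem hasDerivAt_mobius {x y : ℝ} (hy : y ≠ x) :
    HasDerivAt (mobius x) ((x ^ 2 - 1) / (x - y) ^ 2) y := by
  have h : x - y ≠ 0 := sub_ne_zero.2 hy.symm
  have := ((hasDerivAt_const y (x ^ 2 - 1)).div ((hasDerivAt_id y).const_sub x) h).sub_const x
  refine this.congr_deriv ?_
  simp

theorem continuousOn_mobius (x : ℝ) : ContinuousOn (mobius x) {x}ᶜ := fun _ hy =>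
  (hasDerivAt_mobius hy).continuousAt.continuousWithinAt

theorem tendsto_mobius_cobounded (x : ℝ) :
    Tendsto (mobius x) (Bornology.cobounded ℝ) (𝓝 (-x)) := by
  have h := (((tendsto_inv₀_cobounded (α := ℝ)).comp
    (tendsto_add_const_cobounded (-x))).const_mul (-(x ^ 2 - 1))).sub_const x
  rw [mul_zero, zero_sub] at h
  refine h.congr fun y => ?_
  rw [mobius, Function.comp_apply, show x - y = -(y + -x) by ring, div_neg, div_eq_mul_inv]
  ring

theorem abs_lt_one_or {y : ℝ} (h1 : y ≠ 1) (h2 : y ≠ -1) : |y| < 1 ∨ 1 < |y| := by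
  rcases lt_trichotomy (|y|) 1 with h | h | h
  · exact Or.inl h
  · rcases (abs_eq zero_le_one).1 h with h | h <;> contradiction
  · exact Or.inr h

/-- For `|x| < 1` the Möbius map exchanges the inside and the outside of `[-1, 1]`, so the quotient
is, up to a factor, the derivative of `arcsin ∘ mobius x`. -/
theorem extUNegOne_div_sub_of_abs_lt {x y : ℝ} (hx : |x| < 1) (h1 : y ≠ 1) (h2 : y ≠ -1)
    (hy : y ≠ x) :
    extUNegOne y / (x - y) =
      -edge x * (weight (mobius x y) * ((x ^ 2 - 1) / (x - y) ^ 2)) := by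
  have hxy : x - y ≠ 0 := sub_ne_zero.2 hy.symm
  have hx2 : x ^ 2 < 1 := (sq_lt_one_iff_abs_lt_one x).2 hx
  have he := edge_sq_mul (y := x) (by rintro rfl; simp at hx) (by rintro rfl; simp at hx)
  rw [abs_of_neg (by linarith)] at he
  rcases abs_lt_one_or h1 h2 with hy1 | hy1
  · have hy2 : y ^ 2 < 1 := (sq_lt_one_iff_abs_lt_one y).2 hy1
    rw [extUNegOne_of_abs_le hy1.le,
      weight_of_le_abs ((one_lt_abs_mobius_iff hy).2 (by nlinarith)).le]
    simp
  · have hy2 : 1 < y ^ 2 := (one_lt_sq_iff_one_lt_abs y).2 hy1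
    rw [extUNegOne_of_lt_abs hy1, weight_of_abs_lt ((abs_mobius_lt_one_iff hy).2 (by nlinarith)),
      edge_mobius hy]
    have hx' := abs_lt.1 hx
    rcases lt_abs.1 hy1 with h | h
    · rw [Real.sign_of_pos (by linarith), abs_of_neg (by linarith)]
      field_simp
      linear_combination edge y * he
    · rw [Real.sign_of_neg (by linarith), abs_of_pos (by linarith)]
      field_simp
      linear_combination -edge y * he

/-- For `1 < |x|` the Möbius map preserves the inside and the outside of `[-1, 1]`, so the quotient
is, up to a factor, the derivative of `arcsin ∘ mobius x`. -/
theorem weight_div_sub_of_lt_abs {x y : ℝ} (hx : 1 < |x|) (h1 : y ≠ 1) (h2 : y ≠ -1)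
    (hy : y ≠ x) :
    weight y / (x - y) =
      Real.sign x * edge x * (weight (mobius x y) * ((x ^ 2 - 1) / (x - y) ^ 2)) := by
  have hxy : x - y ≠ 0 := sub_ne_zero.2 hy.symm
  have hx2 : 1 < x ^ 2 := (one_lt_sq_iff_one_lt_abs x).2 hx
  have he := edge_sq_mul (y := x) (by rintro rfl; simp at hx) (by rintro rfl; simp at hx)
  rw [abs_of_pos (by linarith)] at he
  rcases abs_lt_one_or h1 h2 with hy1 | hy1
  · have hy2 : y ^ 2 < 1 := (sq_lt_one_iff_abs_lt_one y).2 hy1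
    rw [weight_of_abs_lt hy1, weight_of_abs_lt ((abs_mobius_lt_one_iff hy).2 (by nlinarith)),
      edge_mobius hy]
    have hy' := abs_lt.1 hy1
    rcases lt_abs.1 hx with h | h
    · rw [Real.sign_of_pos (by linarith), abs_of_pos (by linarith)]
      field_simp
      linear_combination -edge y * he
    · rw [Real.sign_of_neg (by linarith), abs_of_neg (by linarith)]
      field_simp
      linear_combination -edge y * he
  · have hy2 : 1 < y ^ 2 := (one_lt_sq_iff_one_lt_abs y).2 hy1
    rw [weight_of_le_abs hy1.le,
      weight_of_le_abs ((one_lt_abs_mobius_iff hy).2 (by nlinarith)).le]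
    simp

/-- For `|x| < 1` the quotient is, up to a factor, the derivative of `clampedArcosh ∘ mobius x`. -/
theorem weight_div_sub_of_abs_lt {x y : ℝ} (hx : |x| < 1) (h1 : y ≠ 1) (h2 : y ≠ -1)
    (hy : y ≠ x) :
    weight y / (x - y) =
      edge x * (-extUNegOne (mobius x y) * ((x ^ 2 - 1) / (x - y) ^ 2)) := by
  have hxy : x - y ≠ 0 := sub_ne_zero.2 hy.symm
  have hx2 : x ^ 2 < 1 := (sq_lt_one_iff_abs_lt_one x).2 hx
  have he := edge_sq_mul (y := x) (by rintro rfl; simp at hx) (by rintro rfl; simp at hx)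
  rw [abs_of_neg (by linarith)] at he
  rcases abs_lt_one_or h1 h2 with hy1 | hy1
  · have hy2 : y ^ 2 < 1 := (sq_lt_one_iff_abs_lt_one y).2 hy1
    rw [weight_of_abs_lt hy1, extUNegOne_of_lt_abs ((one_lt_abs_mobius_iff hy).2 (by nlinarith)),
      edge_mobius hy, mobius_eq hy]
    have hnum : x * y - 1 < 0 := by nlinarith [sq_nonneg (x - y)]
    rcases lt_or_gt_of_ne hxy with h | h
    · rw [Real.sign_of_pos (div_pos_of_neg_of_neg hnum h), abs_of_neg h]
      field_simp
      linear_combination -edge y * he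
    · rw [Real.sign_of_neg (div_neg_of_neg_of_pos hnum h), abs_of_pos h]
      field_simp
      linear_combination -edge y * he
  · have hy2 : 1 < y ^ 2 := (one_lt_sq_iff_one_lt_abs y).2 hy1
    rw [weight_of_le_abs hy1.le,
      extUNegOne_of_abs_le ((abs_mobius_lt_one_iff hy).2 (by nlinarith)).le]
    simp

/-- For `1 < |x|` the quotient is, up to a factor, the derivative of `clampedArcosh ∘ mobius x`. -/
theorem extUNegOne_div_sub_of_lt_abs {x y : ℝ} (hx : 1 < |x|) (h1 : y ≠ 1) (h2 : y ≠ -1)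
    (hy : y ≠ x) :
    extUNegOne y / (x - y) =
      -(Real.sign x * edge x) * (-extUNegOne (mobius x y) * ((x ^ 2 - 1) / (x - y) ^ 2)) := by
  have hxy : x - y ≠ 0 := sub_ne_zero.2 hy.symm
  have hx2 : 1 < x ^ 2 := (one_lt_sq_iff_one_lt_abs x).2 hx
  have he := edge_sq_mul (y := x) (by rintro rfl; simp at hx) (by rintro rfl; simp at hx)
  rw [abs_of_pos (by linarith)] at he
  rcases abs_lt_one_or h1 h2 with hy1 | hy1
  · have hy2 : y ^ 2 < 1 := (sq_lt_one_iff_abs_lt_one y).2 hy1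
    rw [extUNegOne_of_abs_le hy1.le,
      extUNegOne_of_abs_le ((abs_mobius_lt_one_iff hy).2 (by nlinarith)).le]
    simp
  · have hy2 : 1 < y ^ 2 := (one_lt_sq_iff_one_lt_abs y).2 hy1
    -- The numerator of the Möbius map has the sign of `x * y`.
    have hsign : Real.sign (mobius x y) = Real.sign x * Real.sign y * Real.sign (x - y) := by
      rw [mobius_eq hy]
      rcases lt_abs.1 hx with hx' | hx' <;> rcases lt_abs.1 hy1 with hy' | hy' <;>
        rcases lt_or_gt_of_ne hxy with h | h
      · rw [Real.sign_of_pos (r := x) (by linarith), Real.sign_of_pos (r := y) (by linarith),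
          Real.sign_of_neg h, Real.sign_of_neg (div_neg_of_pos_of_neg (by nlinarith) h)]
        norm_num
      · rw [Real.sign_of_pos (r := x) (by linarith), Real.sign_of_pos (r := y) (by linarith),
          Real.sign_of_pos h, Real.sign_of_pos (div_pos (by nlinarith) h)]
        norm_num
      · linarith
      · rw [Real.sign_of_pos (r := x) (by linarith), Real.sign_of_neg (r := y) (by linarith),
          Real.sign_of_pos h, Real.sign_of_neg (div_neg_of_neg_of_pos (by nlinarith) h)]
        norm_num
      · rw [Real.sign_of_neg (r := x) (by linarith), Real.sign_of_pos (r := y) (by linarith),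
          Real.sign_of_neg h, Real.sign_of_pos (div_pos_of_neg_of_neg (by nlinarith) h)]
        norm_num
      · linarith
      · rw [Real.sign_of_neg (r := x) (by linarith), Real.sign_of_neg (r := y) (by linarith),
          Real.sign_of_neg h, Real.sign_of_neg (div_neg_of_pos_of_neg (by nlinarith) h)]
        norm_num
      · rw [Real.sign_of_neg (r := x) (by linarith), Real.sign_of_neg (r := y) (by linarith),
          Real.sign_of_pos h, Real.sign_of_pos (div_pos (by nlinarith) h)]
        norm_num
    have hsx : Real.sign x ^ 2 = 1 := by
      rcases Real.sign_apply_eq_of_ne_zero x (by rintro rfl; simp at hx; linarith) with h | h <;>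
        simp [h]
    have habs : Real.sign (x - y) * |x - y| = x - y := by
      rcases lt_or_gt_of_ne hxy with h | h
      · rw [Real.sign_of_neg h, abs_of_neg h]; ring
      · rw [Real.sign_of_pos h, abs_of_pos h]; ring
    rw [extUNegOne_of_lt_abs hy1,
      extUNegOne_of_lt_abs ((one_lt_abs_mobius_iff hy).2 (by nlinarith)), edge_mobius hy, hsign]
    have : Real.sign x * Real.sign y * Real.sign (x - y) * (|x - y| * edge x * edge y) =
        Real.sign x * Real.sign y * (x - y) * edge x * edge y := by
      linear_combination Real.sign x * Real.sign y * edge x * edge y * habs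
    rw [this]
    field_simp
    linear_combination Real.sign y * edge y * (Real.sign x ^ 2 * he + hsx)

/-! ### Integrability of the endpoint singularities -/

theorem measurable_edge : Measurable edge := by
  unfold edge
  fun_prop

theorem measurable_weight : Measurable weight := by
  unfold weight
  exact Measurable.ite (measurableSet_lt (by fun_prop) measurable_const) (by fun_prop)
    measurable_const

theorem measurable_sign : Measurable Real.sign := by
  unfold Real.sign
  exact Measurable.ite measurableSet_Iio measurable_const
    (Measurable.ite measurableSet_Ioi measurable_const measurable_const)

theorem measurable_extUNegOne : Measurable extUNegOne := by
  unfold extUNegOne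
  have := measurable_sign
  exact Measurable.ite (measurableSet_le (by fun_prop) measurable_const) measurable_const
    (by fun_prop)

theorem edge_le_of_two_lt_abs {y : ℝ} (hy : 2 < |y|) : edge y ≤ 2 / (1 + |y|) := by
  have h : 1 + |y| ≤ 2 * √|y ^ 2 - 1| := by
    have h2 : 0 ≤ y ^ 2 - 1 := by nlinarith [sq_abs y]
    rw [abs_of_nonneg h2]
    have : (1 + |y|) / 2 ≤ √(y ^ 2 - 1) := by
      apply Real.le_sqrt_of_sq_le
      nlinarith [sq_abs y]
    linarith
  have h0 : 0 < √|y ^ 2 - 1| := by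
    have := abs_nonneg y
    linarith
  rw [edge, div_le_div_iff₀ h0 (by positivity)]
  linarith

theorem integrable_edge_rpow {p : ℝ} (h1 : 1 < p) (h2 : p < 2) :
    Integrable (fun y => edge y ^ p) := by
  have hmeas : AEStronglyMeasurable (fun y => edge y ^ p) volume :=
    (measurable_edge.pow_const p).aestronglyMeasurable
  rw [← integrableOn_univ, ← Set.union_compl_self (Set.Icc (-2 : ℝ) 2)]
  refine IntegrableOn.union ?_ ?_
  · have hloc : ∀ c : ℝ, IntegrableOn (fun y : ℝ => |y - c| ^ (-(p / 2))) (Set.Icc (-2) 2) := by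
      intro c
      have hb : ∀ A : ℝ, 0 ≤ A → IntervalIntegrable (fun y : ℝ => |y| ^ (-(p / 2))) volume 0 A := by
        intro A hA
        refine (intervalIntegral.intervalIntegrable_rpow' (r := -(p / 2)) (by linarith)).congr
          fun y hy => ?_
        rw [Set.uIoc_of_le hA] at hy
        simp only [abs_of_pos hy.1]
      have hb' : ∀ A : ℝ, IntervalIntegrable (fun y : ℝ => |y| ^ (-(p / 2))) volume 0 A := by
        intro A
        rcases le_total 0 A with hA | hA
        · exact hb A hA
        · have := (hb (-A) (by linarith)).comp_mul_left (c := -1)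
          simpa using this
      have h := ((hb' (-2 - c)).symm.trans (hb' (2 - c))).comp_sub_right c
      simp only [sub_add_cancel] at h
      exact integrableOn_Icc_iff_integrableOn_Ioc (by simp) |>.2
        ((intervalIntegrable_iff_integrableOn_Ioc_of_le (by norm_num)).1 h)
    refine ((hloc 1).add (hloc (-1))).mono' hmeas.restrict ?_
    filter_upwards [ae_restrict_of_ae (compl_mem_ae_iff.2 (measure_singleton (1 : ℝ))),
      ae_restrict_of_ae (compl_mem_ae_iff.2 (measure_singleton (-1 : ℝ)))] with y hy1 hy2
    have hp1 : 0 < |y - 1| := abs_pos.2 (sub_ne_zero.2 hy1)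
    have hp2 : 0 < |y - -1| := abs_pos.2 (sub_ne_zero.2 hy2)
    have hfac : edge y ^ p = |y - 1| ^ (-(p / 2)) * |y - -1| ^ (-(p / 2)) := by
      rw [edge, show y ^ 2 - 1 = (y - 1) * (y - -1) by ring, abs_mul, Real.sqrt_eq_rpow, one_div,
        ← Real.rpow_neg (by positivity), ← Real.rpow_mul (by positivity),
        Real.mul_rpow hp1.le hp2.le]
      congr 2 <;> ring
    rw [Real.norm_of_nonneg (Real.rpow_nonneg (edge_nonneg y) p), hfac, Pi.add_apply]
    have hn1 := Real.rpow_nonneg hp1.le (-(p / 2))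
    have hn2 := Real.rpow_nonneg hp2.le (-(p / 2))
    -- At least one of the endpoints `1` and `-1` is at distance at least `1` from `y`.
    rcases le_total 0 y with h | h
    · have : |y - -1| ^ (-(p / 2)) ≤ 1 :=
        Real.rpow_le_one_of_one_le_of_nonpos (le_abs.2 (Or.inl (by linarith))) (by linarith)
      nlinarith
    · have : |y - 1| ^ (-(p / 2)) ≤ 1 :=
        Real.rpow_le_one_of_one_le_of_nonpos (le_abs.2 (Or.inr (by linarith))) (by linarith)
      nlinarith
  · have hdec : Integrable (fun y : ℝ => (1 + ‖y‖) ^ (-p)) :=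
      integrable_one_add_norm (by simpa using h1)
    refine ((hdec.const_mul (2 ^ p)).integrableOn).mono' hmeas.restrict ?_
    filter_upwards [ae_restrict_mem measurableSet_Icc.compl] with y hy
    have hy : 2 < |y| := by
      by_contra h
      exact hy (abs_le.1 (not_lt.1 h))
    rw [Real.norm_of_nonneg (Real.rpow_nonneg (edge_nonneg y) p), Real.norm_eq_abs]
    calc edge y ^ p ≤ (2 / (1 + |y|)) ^ p :=
          Real.rpow_le_rpow (edge_nonneg y) (edge_le_of_two_lt_abs hy) (by linarith)
      _ = 2 ^ p * (1 + |y|) ^ (-p) := by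
          rw [Real.div_rpow two_pos.le (by positivity), Real.rpow_neg (by positivity)]
          rfl

theorem memLp_edge {p : ℝ≥0∞} (h1 : 1 < p) (h2 : p < 2) : MemLp edge p volume := by
  have ht : p ≠ ⊤ := (h2.trans (by simp)).ne
  rw [← integrable_norm_rpow_iff measurable_edge.aestronglyMeasurable (by positivity) ht]
  have h1' : 1 < p.toReal := by simpa using (ENNReal.toReal_lt_toReal (by simp) ht).2 h1
  have h2' : p.toReal < 2 := by simpa using (ENNReal.toReal_lt_toReal ht (by simp)).2 h2
  simpa only [Real.norm_of_nonneg (edge_nonneg _)] using integrable_edge_rpow h1' h2'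

/-- An integrable majorant: the endpoint singularities together with quadratic decay. -/
def edgeDecay (y : ℝ) : ℝ := edge y / (1 + |y|)

theorem edgeDecay_le_edge (y : ℝ) : edgeDecay y ≤ edge y :=
  div_le_self (edge_nonneg y) (by linarith [abs_nonneg y])

theorem integrable_edgeDecay : Integrable edgeDecay := by
  have hdec : Integrable (fun y : ℝ => (1 + ‖y‖) ^ (-(3 : ℝ))) :=
    integrable_one_add_norm (by norm_num)
  refine ((integrable_edge_rpow (p := 3 / 2) (by norm_num) (by norm_num)).add hdec).mono'
    (measurable_edge.div (by fun_prop)).aestronglyMeasurable (Eventually.of_forall fun y => ?_)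
  have hpos : 0 < 1 + |y| := by positivity
  rw [edgeDecay, Real.norm_of_nonneg (div_nonneg (edge_nonneg y) hpos.le), Pi.add_apply,
    Real.norm_eq_abs, div_eq_mul_inv]
  have hY := Real.young_inequality_of_nonneg (edge_nonneg y) (inv_nonneg.2 hpos.le)
    (p := 3 / 2) (q := 3) (by constructor <;> norm_num)
  have h3 : (1 + |y|)⁻¹ ^ (3 : ℝ) = (1 + |y|) ^ (-(3 : ℝ)) := by
    rw [Real.inv_rpow hpos.le, Real.rpow_neg hpos.le]
  rw [h3] at hY
  have ha := Real.rpow_nonneg (edge_nonneg y) (3 / 2)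
  have hb := Real.rpow_nonneg hpos.le (-3)
  linarith

theorem integrable_of_abs_le_edgeDecay {u : ℝ → ℝ} (hm : Measurable u) {C : ℝ}
    (h : ∀ y, y ≠ 1 → y ≠ -1 → |u y| ≤ C * edgeDecay y) : Integrable u := by
  refine (integrable_edgeDecay.const_mul C).mono' hm.aestronglyMeasurable ?_
  filter_upwards [compl_mem_ae_iff.2 (measure_singleton (1 : ℝ)),
    compl_mem_ae_iff.2 (measure_singleton (-1 : ℝ))] with y hy1 hy2 using h y hy1 hy2

theorem memLp_of_abs_le_edge {u : ℝ → ℝ} (hm : Measurable u) {C : ℝ}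
    (h : ∀ y, y ≠ 1 → y ≠ -1 → |u y| ≤ C * edge y) {p : ℝ≥0∞} (h1 : 1 < p) (h2 : p < 2) :
    MemLp u p volume := by
  refine ((memLp_edge h1 h2).const_mul C).mono' hm.aestronglyMeasurable ?_
  filter_upwards [compl_mem_ae_iff.2 (measure_singleton (1 : ℝ)),
    compl_mem_ae_iff.2 (measure_singleton (-1 : ℝ))] with y hy1 hy2 using h y hy1 hy2

/-- Away from `x` the Hilbert kernel decays like `1 / (1 + |y|)`, so the truncated integrals of
functions bounded by `edge` converge absolutely. -/
theorem integrableOn_div_sub {u : ℝ → ℝ} (hm : Measurable u)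
    (h : ∀ y, y ≠ 1 → y ≠ -1 → |u y| ≤ edge y) (x : ℝ) {ε : ℝ} (hε : 0 < ε) :
    IntegrableOn (fun y => u y / (x - y)) {y : ℝ | ε < |x - y|} := by
  refine ((integrable_edgeDecay.const_mul ((1 + |x|) / ε + 1)).integrableOn).mono'
    (hm.div (by fun_prop)).aestronglyMeasurable ?_
  filter_upwards [ae_restrict_mem (measurableSet_lt_abs_sub x ε),
    ae_restrict_of_ae (compl_mem_ae_iff.2 (measure_singleton (1 : ℝ))),
    ae_restrict_of_ae (compl_mem_ae_iff.2 (measure_singleton (-1 : ℝ)))] with y hy hy1 hy2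
  have hy : ε < |x - y| := hy
  have hpos : 0 < |x - y| := hε.trans hy
  have hk : 1 + |y| ≤ ((1 + |x|) / ε + 1) * |x - y| := by
    have h1 : |y| ≤ |x| + |x - y| := by
      have := abs_sub x (x - y)
      rwa [sub_sub_cancel] at this
    have h2 : 1 + |x| ≤ (1 + |x|) / ε * |x - y| := by
      rw [div_mul_eq_mul_div, le_div_iff₀ hε]
      have := abs_nonneg x
      gcongr
    linarith
  rw [Real.norm_eq_abs, abs_div, edgeDecay, mul_div_assoc', div_le_div_iff₀ hpos (by positivity)]
  calc |u y| * (1 + |y|) ≤ edge y * (((1 + |x|) / ε + 1) * |x - y|) :=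
        mul_le_mul (h y hy1 hy2) hk (by positivity) (edge_nonneg y)
    _ = _ := by ring

theorem abs_weight_le (y : ℝ) : |weight y| ≤ edge y := by
  rcases lt_or_ge (|y|) 1 with h | h
  · rw [weight_of_abs_lt h, abs_of_nonneg (edge_nonneg y)]
  · rw [weight_of_le_abs h, abs_zero]
    exact edge_nonneg y

theorem abs_sign_le_one (y : ℝ) : |Real.sign y| ≤ 1 := by
  rcases Real.sign_apply_eq y with h | h | h <;> simp [h]

theorem abs_extUNegOne_le (y : ℝ) : |extUNegOne y| ≤ edge y := by
  rcases le_or_gt (|y|) 1 with h | h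
  · rw [extUNegOne_of_abs_le h, abs_zero]
    exact edge_nonneg y
  · rw [extUNegOne_of_lt_abs h, abs_neg, abs_mul, abs_of_nonneg (edge_nonneg y)]
    exact mul_le_of_le_one_left (edge_nonneg y) (abs_sign_le_one y)

/-! ### Hilbert transforms of the two densities -/

theorem mobius_left (x ε : ℝ) : mobius x (x - ε) = (x ^ 2 - 1) * ε⁻¹ - x := by
  rw [mobius, sub_sub_cancel, div_eq_mul_inv]

theorem mobius_right (x ε : ℝ) : mobius x (x + ε) = -((x ^ 2 - 1) * ε⁻¹) - x := by
  rw [mobius, sub_add_cancel_left, div_neg, div_eq_mul_inv]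

theorem ne_of_sq_ne_one {x : ℝ} (h1 : x ≠ 1) (h2 : x ≠ -1) : x ^ 2 - 1 ≠ 0 :=
  sub_ne_zero.2 (by simp [sq_eq_one_iff, h1, h2])

theorem mobius_ne {x y : ℝ} (hx1 : x ≠ 1) (hx2 : x ≠ -1) (hy : y ≠ x) (h1 : y ≠ 1)
    (h2 : y ≠ -1) : mobius x y ≠ 1 ∧ mobius x y ≠ -1 := by
  have h := mobius_sq_sub_one hy
  have hne : (x ^ 2 - 1) * (y ^ 2 - 1) / (x - y) ^ 2 ≠ 0 :=
    div_ne_zero (mul_ne_zero (ne_of_sq_ne_one hx1 hx2) (ne_of_sq_ne_one h1 h2))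
      (pow_ne_zero 2 (sub_ne_zero.2 hy.symm))
  constructor <;> intro h' <;> rw [h'] at h <;> norm_num at h <;> simp_all

theorem hasDerivAt_arcsin_mobius {x y : ℝ} (hx1 : x ≠ 1) (hx2 : x ≠ -1) (hy : y ≠ x)
    (h1 : y ≠ 1) (h2 : y ≠ -1) :
    HasDerivAt (fun y => Real.arcsin (mobius x y))
      (weight (mobius x y) * ((x ^ 2 - 1) / (x - y) ^ 2)) y :=
  have h := mobius_ne hx1 hx2 hy h1 h2
  (hasDerivAt_arcsin_weight h.1 h.2).comp y (hasDerivAt_mobius hy)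

theorem hasDerivAt_clampedArcosh_mobius {x y : ℝ} (hx1 : x ≠ 1) (hx2 : x ≠ -1) (hy : y ≠ x)
    (h1 : y ≠ 1) (h2 : y ≠ -1) :
    HasDerivAt (fun y => clampedArcosh (mobius x y))
      (-extUNegOne (mobius x y) * ((x ^ 2 - 1) / (x - y) ^ 2)) y :=
  have h := mobius_ne hx1 hx2 hy h1 h2
  (hasDerivAt_clampedArcosh h.1 h.2).comp y (hasDerivAt_mobius hy)

/-- The jump of `arcsin ∘ mobius x` across its pole. -/
theorem tendsto_arcsin_mobius_jump {x : ℝ} (hx1 : x ≠ 1) (hx2 : x ≠ -1) :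
    Tendsto (fun ε => Real.arcsin (mobius x (x - ε)) - Real.arcsin (mobius x (x + ε))) (𝓝[>] 0)
      (𝓝 (Real.sign (x ^ 2 - 1) * Real.pi)) := by
  simp only [mobius_left, mobius_right]
  have hinv := tendsto_inv_nhdsGT_zero (𝕜 := ℝ)
  refine tendsto_const_nhds.congr' ?_
  rcases lt_or_gt_of_ne (ne_of_sq_ne_one hx1 hx2) with h | h
  · filter_upwards [(hinv.const_mul_atTop_of_neg h).eventually_le_atBot (-(1 + |x|))] with ε hε
    rw [Real.sign_of_neg h, Real.arcsin_of_le_neg_one (by linarith [neg_abs_le x]),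
      Real.arcsin_of_one_le (by linarith [le_abs_self x])]
    ring
  · filter_upwards [(hinv.const_mul_atTop h).eventually_ge_atTop (1 + |x|)] with ε hε
    rw [Real.sign_of_pos h, Real.arcsin_of_one_le (by linarith [le_abs_self x]),
      Real.arcsin_of_le_neg_one (by linarith [neg_abs_le x])]
    ring

/-- `clampedArcosh ∘ mobius x` has no jump across its pole: its singularity is symmetric. -/
theorem tendsto_clampedArcosh_mobius_jump {x : ℝ} (hx1 : x ≠ 1) (hx2 : x ≠ -1) :
    Tendsto (fun ε => clampedArcosh (mobius x (x - ε)) - clampedArcosh (mobius x (x + ε)))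
      (𝓝[>] 0) (𝓝 0) := by
  have hinv := tendsto_inv_nhdsGT_zero (𝕜 := ℝ)
  have hlim : Tendsto (fun ε : ℝ => (x ^ 2 - 1) * ε⁻¹ + x) (𝓝[>] 0) (Bornology.cobounded ℝ) := by
    refine (tendsto_add_const_cobounded x).comp ?_
    rw [IsOrderBornology.cobounded_eq]
    rcases lt_or_gt_of_ne (ne_of_sq_ne_one hx1 hx2) with h | h
    · exact (hinv.const_mul_atTop_of_neg h).mono_right le_sup_left
    · exact (hinv.const_mul_atTop h).mono_right le_sup_right
  refine ((tendsto_clampedArcosh_add_const_sub (-2 * x)).comp hlim).congr fun ε => ?_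
  rw [mobius_left, mobius_right, Function.comp_apply, ← clampedArcosh_neg (-_ - x)]
  congr 2 <;> ring

theorem continuousOn_arcsin_mobius (x : ℝ) :
    ContinuousOn (fun y => Real.arcsin (mobius x y)) {x}ᶜ :=
  Real.continuous_arcsin.comp_continuousOn (continuousOn_mobius x)

theorem continuousOn_clampedArcosh_mobius (x : ℝ) :
    ContinuousOn (fun y => clampedArcosh (mobius x y)) {x}ᶜ :=
  continuous_clampedArcosh.comp_continuousOn (continuousOn_mobius x)

theorem tendsto_arcsin_mobius (x : ℝ) :
    Tendsto (fun y => Real.arcsin (mobius x y)) (Bornology.cobounded ℝ)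
      (𝓝 (Real.arcsin (-x))) :=
  (Real.continuous_arcsin.tendsto _).comp (tendsto_mobius_cobounded x)

theorem tendsto_clampedArcosh_mobius (x : ℝ) :
    Tendsto (fun y => clampedArcosh (mobius x y)) (Bornology.cobounded ℝ)
      (𝓝 (clampedArcosh (-x))) :=
  (continuous_clampedArcosh.tendsto _).comp (tendsto_mobius_cobounded x)

/-- The Hilbert transform of a function for which `u y / (x - y)` is a multiple of the derivative
of `arcsin ∘ mobius x`. -/
theorem hasHilbertTransformAt_of_arcsin {u : ℝ → ℝ} (hm : Measurable u)
    (hu : ∀ y, |u y| ≤ edge y) {x c h : ℝ} (hx1 : x ≠ 1) (hx2 : x ≠ -1)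
    (hker : ∀ y, y ≠ 1 → y ≠ -1 → y ≠ x →
      u y / (x - y) = c * (weight (mobius x y) * ((x ^ 2 - 1) / (x - y) ^ 2)))
    (hh : c * Real.sign (x ^ 2 - 1) = h) : HasHilbertTransformAt u h x := by
  refine hasHilbertTransformAt_of_hasDerivAt (F := fun y => c * Real.arcsin (mobius x y))
    (s := {1, -1}) (Set.to_countable _)
    (fun ε hε => integrableOn_div_sub hm (fun y _ _ => hu y) x hε)
    ((continuousOn_arcsin_mobius x).const_mul c) (fun y hy hs => ?_)
    ((tendsto_arcsin_mobius x).const_mul c) ?_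
  · simp only [Set.mem_insert_iff, Set.mem_singleton_iff, not_or] at hs
    rw [hker y hs.1 hs.2 hy]
    exact (hasDerivAt_arcsin_mobius hx1 hx2 hy hs.1 hs.2).const_mul c
  · have := (tendsto_arcsin_mobius_jump hx1 hx2).const_mul c
    simp only [← mul_sub]
    rwa [← hh, show Real.pi * (c * Real.sign (x ^ 2 - 1)) =
      c * (Real.sign (x ^ 2 - 1) * Real.pi) by ring]

/-- The Hilbert transform vanishes where `u y / (x - y)` is a multiple of the derivative of
`clampedArcosh ∘ mobius x`. -/
theorem hasHilbertTransformAt_of_clampedArcosh {u : ℝ → ℝ} (hm : Measurable u)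
    (hu : ∀ y, |u y| ≤ edge y) {x c : ℝ} (hx1 : x ≠ 1) (hx2 : x ≠ -1)
    (hker : ∀ y, y ≠ 1 → y ≠ -1 → y ≠ x →
      u y / (x - y) = c * (-extUNegOne (mobius x y) * ((x ^ 2 - 1) / (x - y) ^ 2))) :
    HasHilbertTransformAt u 0 x := by
  refine hasHilbertTransformAt_of_hasDerivAt (F := fun y => c * clampedArcosh (mobius x y))
    (s := {1, -1}) (Set.to_countable _)
    (fun ε hε => integrableOn_div_sub hm (fun y _ _ => hu y) x hε)
    ((continuousOn_clampedArcosh_mobius x).const_mul c) (fun y hy hs => ?_)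
    ((tendsto_clampedArcosh_mobius x).const_mul c) ?_
  · simp only [Set.mem_insert_iff, Set.mem_singleton_iff, not_or] at hs
    rw [hker y hs.1 hs.2 hy]
    exact (hasDerivAt_clampedArcosh_mobius hx1 hx2 hy hs.1 hs.2).const_mul c
  · have := (tendsto_clampedArcosh_mobius_jump hx1 hx2).const_mul c
    simp only [← mul_sub]
    simpa using this

theorem hasHilbertTransformAt_weight {x : ℝ} (hx1 : x ≠ 1) (hx2 : x ≠ -1) :
    HasHilbertTransformAt weight (-extUNegOne x) x := by
  rcases abs_lt_one_or hx1 hx2 with hx | hx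
  · rw [extUNegOne_of_abs_le hx.le, neg_zero]
    exact hasHilbertTransformAt_of_clampedArcosh measurable_weight abs_weight_le hx1 hx2
      fun y h1 h2 hy => weight_div_sub_of_abs_lt hx h1 h2 hy
  · refine hasHilbertTransformAt_of_arcsin measurable_weight abs_weight_le hx1 hx2
      (fun y h1 h2 hy => weight_div_sub_of_lt_abs hx h1 h2 hy) ?_
    rw [Real.sign_of_pos (sub_pos.2 ((one_lt_sq_iff_one_lt_abs x).2 hx)),
      extUNegOne_of_lt_abs hx]
    ring

theorem hasHilbertTransformAt_extUNegOne {x : ℝ} (hx1 : x ≠ 1) (hx2 : x ≠ -1) :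
    HasHilbertTransformAt extUNegOne (weight x) x := by
  rcases abs_lt_one_or hx1 hx2 with hx | hx
  · refine hasHilbertTransformAt_of_arcsin measurable_extUNegOne abs_extUNegOne_le hx1 hx2
      (fun y h1 h2 hy => extUNegOne_div_sub_of_abs_lt hx h1 h2 hy) ?_
    rw [Real.sign_of_neg (sub_neg.2 ((sq_lt_one_iff_abs_lt_one x).2 hx)), weight_of_abs_lt hx]
    ring
  · rw [weight_of_le_abs hx.le]
    exact hasHilbertTransformAt_of_clampedArcosh measurable_extUNegOne abs_extUNegOne_le hx1 hx2
      fun y h1 h2 hy => extUNegOne_div_sub_of_lt_abs hx h1 h2 hy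

/-! ### Closed forms of the extended Chebyshev functions -/

/-- The root of smaller modulus of `q ^ 2 - 2 * y * q + 1`, for `1 < |y|`. The extended Chebyshev
functions of the first kind are its powers there. -/
def decayRoot (y : ℝ) : ℝ := y - Real.sign y * √(y ^ 2 - 1)

theorem sign_sq_of_lt_abs {y : ℝ} (hy : 1 < |y|) : Real.sign y ^ 2 = 1 := by
  rcases Real.sign_apply_eq_of_ne_zero y (by rintro rfl; simp at hy; linarith) with h | h <;>
    simp [h]

theorem sqrt_pos_of_lt_abs {y : ℝ} (hy : 1 < |y|) : 0 < √(y ^ 2 - 1) :=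
  Real.sqrt_pos.2 (sub_pos.2 ((one_lt_sq_iff_one_lt_abs y).2 hy))

theorem extUNegOne_mul_sqrt {y : ℝ} (hy : 1 < |y|) :
    extUNegOne y * (Real.sign y * √(y ^ 2 - 1)) = -1 := by
  have h := sqrt_pos_of_lt_abs hy
  rw [extUNegOne, if_neg (not_le.2 hy)]
  field_simp
  linarith [sign_sq_of_lt_abs hy]

theorem decayRoot_sq {y : ℝ} (hy : 1 < |y|) : decayRoot y ^ 2 = 2 * y * decayRoot y - 1 := by
  have h := Real.sq_sqrt (sub_pos.2 ((one_lt_sq_iff_one_lt_abs y).2 hy)).le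
  have hs := sign_sq_of_lt_abs hy
  rw [decayRoot]
  linear_combination Real.sign y ^ 2 * h + (y ^ 2 - 1) * hs

theorem one_add_mul_extUNegOne {y : ℝ} (hy : 1 < |y|) :
    1 + y * extUNegOne y = decayRoot y * extUNegOne y := by
  rw [decayRoot]
  linear_combination extUNegOne_mul_sqrt hy

theorem decayRoot_sq_sub_one_mul {y : ℝ} (hy : 1 < |y|) :
    (decayRoot y ^ 2 - 1) * extUNegOne y = 2 * decayRoot y := by
  have h1 := one_add_mul_extUNegOne hy
  have h2 := decayRoot_sq hy
  linear_combination -extUNegOne y * h2 - 2 * decayRoot y * h1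

theorem abs_decayRoot_le {y : ℝ} (hy : 1 < |y|) : |decayRoot y| ≤ 1 / |y| := by
  have h := Real.sq_sqrt (sub_pos.2 ((one_lt_sq_iff_one_lt_abs y).2 hy)).le
  have h0 := sqrt_pos_of_lt_abs hy
  have key : |decayRoot y| * (|y| + √(y ^ 2 - 1)) = 1 := by
    have habs : |y + Real.sign y * √(y ^ 2 - 1)| = |y| + √(y ^ 2 - 1) := by
      rcases lt_abs.1 hy with h' | h'
      · rw [Real.sign_of_pos (by linarith), abs_of_pos (by linarith), abs_of_pos (by linarith)]
        ring
      · rw [Real.sign_of_neg (by linarith), abs_of_neg (by linarith), abs_of_neg (by linarith)]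
        ring
    rw [← habs, ← abs_mul, decayRoot]
    rw [show (y - Real.sign y * √(y ^ 2 - 1)) * (y + Real.sign y * √(y ^ 2 - 1)) = 1 by
      linear_combination -Real.sign y ^ 2 * h - (y ^ 2 - 1) * sign_sq_of_lt_abs hy, abs_one]
  rw [le_div_iff₀ (by linarith)]
  nlinarith [abs_nonneg (decayRoot y)]

theorem extT_of_abs_le {y : ℝ} (hy : |y| ≤ 1) (n : ℕ) :
    extT n y = (Polynomial.Chebyshev.T ℝ (n : ℤ)).eval y := by
  rw [extT, if_pos hy]

theorem extT_of_lt_abs {y : ℝ} (hy : 1 < |y|) (n : ℕ) : extT n y = decayRoot y ^ n := by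
  rw [extT, if_neg (not_le.2 hy), decayRoot]

theorem extUNegTwo_eq (y : ℝ) : extUNegTwo y = y * extUNegOne y := by
  rw [extUNegTwo, extUNegOne]
  split_ifs with h
  · simp
  · rcases lt_abs.1 (not_le.1 h) with h' | h'
    · rw [Real.sign_of_pos (by linarith), abs_of_pos (by linarith)]
      ring
    · rw [Real.sign_of_neg (by linarith), abs_of_neg (by linarith)]
      ring

theorem extU_zero_eq (y : ℝ) : extU 0 y = 1 + y * extUNegOne y := by
  rw [extU, extUNegTwo_eq, extT]
  simp

theorem extU_of_abs_le {y : ℝ} (hy : |y| ≤ 1) :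
    ∀ n : ℕ, extU n y = (Polynomial.Chebyshev.U ℝ (n : ℤ)).eval y
  | 0 => by simp [extU_zero_eq, extUNegOne_of_abs_le hy]
  | 1 => by simp [extU, extT_of_abs_le hy, extUNegOne_of_abs_le hy]
  | n + 2 => by
    rw [extU, extU_of_abs_le hy n, extT_of_abs_le hy]
    have := congrArg (Polynomial.eval y) (Polynomial.Chebyshev.U_eq_two_mul_T_add_U ℝ (n : ℤ))
    simpa using this.symm

/-- Outside `[-1, 1]` the function `extU n` decays like `y ^ (-(n + 2))`, although the summands in
its definition do not. -/
theorem extU_of_lt_abs {y : ℝ} (hy : 1 < |y|) :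
    ∀ n : ℕ, extU n y = decayRoot y ^ (n + 1) * extUNegOne y
  | 0 => by rw [extU_zero_eq, one_add_mul_extUNegOne hy, zero_add, pow_one]
  | 1 => by
    rw [extU, extT_of_lt_abs hy]
    linear_combination -decayRoot_sq_sub_one_mul hy
  | n + 2 => by
    rw [extU, extU_of_lt_abs hy n, extT_of_lt_abs hy]
    linear_combination -decayRoot y ^ (n + 1) * decayRoot_sq_sub_one_mul hy

theorem extU_one_eq (y : ℝ) : extU 1 y = 2 * y * extU 0 y - extUNegOne y := by
  rcases le_or_gt (|y|) 1 with hy | hy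
  · simp [extU_of_abs_le hy, extUNegOne_of_abs_le hy]
  · rw [extU_of_lt_abs hy, extU_of_lt_abs hy]
    linear_combination extUNegOne y * decayRoot_sq hy

theorem extU_add_two_eq (n : ℕ) (y : ℝ) :
    extU (n + 2) y = 2 * y * extU (n + 1) y - extU n y := by
  rcases le_or_gt (|y|) 1 with hy | hy
  · rw [extU_of_abs_le hy, extU_of_abs_le hy, extU_of_abs_le hy]
    simp [Polynomial.Chebyshev.U_add_two]
  · rw [extU_of_lt_abs hy, extU_of_lt_abs hy, extU_of_lt_abs hy]
    linear_combination decayRoot y ^ (n + 1) * extUNegOne y * decayRoot_sq hy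

theorem weightedT_zero_eq (y : ℝ) : weightedT 0 y = weight y := by
  simp [weightedT]

theorem weightedT_one_eq (y : ℝ) : weightedT 1 y = y * weight y := by
  simp [weightedT, mul_comm]

theorem weightedT_add_two_eq (n : ℕ) (y : ℝ) :
    weightedT (n + 2) y = 2 * y * weightedT (n + 1) y - weightedT n y := by
  have := congrArg (Polynomial.eval y) (Polynomial.Chebyshev.T_add_two ℝ (n : ℤ))
  simp only [Polynomial.eval_sub, Polynomial.eval_mul, Polynomial.eval_X,
    Polynomial.eval_ofNat] at this
  simp only [weightedT]
  push_cast
  rw [this]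
  ring

/-! ### Bounds and integrals of the Chebyshev functions -/

theorem measurable_extT (n : ℕ) : Measurable (extT n) := by
  unfold extT
  have := measurable_sign
  exact Measurable.ite (measurableSet_le (by fun_prop) measurable_const)
    (Polynomial.continuous _).measurable (by fun_prop)

theorem measurable_extU : ∀ n : ℕ, Measurable (extU n)
  | 0 => by
    rw [funext extU_zero_eq]
    have := measurable_extUNegOne
    fun_prop
  | 1 => by
    have h1 := measurable_extT 1
    have h2 := measurable_extUNegOne
    change Measurable fun y => 2 * extT 1 y + extUNegOne y
    fun_prop
  | n + 2 => by
    have h1 := measurable_extT (n + 2)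
    have h2 := measurable_extU n
    change Measurable fun y => 2 * extT (n + 2) y + extU n y
    fun_prop

theorem measurable_weightedT (n : ℕ) : Measurable (weightedT n) :=
  measurable_weight.mul (Polynomial.continuous _).measurable

theorem one_le_edge_of_abs_lt {y : ℝ} (hy : |y| < 1) : 1 ≤ edge y := by
  have h : y ^ 2 < 1 := (sq_lt_one_iff_abs_lt_one y).2 hy
  rw [edge, abs_of_neg (by linarith), one_le_div (Real.sqrt_pos.2 (by linarith)),
    Real.sqrt_le_one]
  linarith [sq_nonneg y]

theorem edge_le_two_mul_edgeDecay {y : ℝ} (hy : |y| ≤ 1) : edge y ≤ 2 * edgeDecay y := by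
  rw [edgeDecay, mul_div_assoc', le_div_iff₀ (by positivity)]
  nlinarith [edge_nonneg y]

theorem abs_weightedT_le (n : ℕ) (y : ℝ) : |weightedT n y| ≤ 2 * edgeDecay y := by
  rcases lt_or_ge (|y|) 1 with hy | hy
  · refine le_trans ?_ (edge_le_two_mul_edgeDecay hy.le)
    rw [weightedT, abs_mul]
    exact (mul_le_of_le_one_right (abs_nonneg _)
      (Polynomial.Chebyshev.abs_eval_T_real_le_one n hy.le)).trans (abs_weight_le y)
  · rw [weightedT, weight_of_le_abs hy, zero_mul, abs_zero]
    exact mul_nonneg two_pos.le (div_nonneg (edge_nonneg y) (by positivity))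

theorem exists_abs_extU_le (n : ℕ) :
    ∃ C, ∀ y, y ≠ 1 → y ≠ -1 → |extU n y| ≤ C * edgeDecay y := by
  obtain ⟨C, hC⟩ := (isCompact_Icc (a := (-1 : ℝ)) (b := 1)).exists_bound_of_continuousOn
    (Polynomial.continuous (Polynomial.Chebyshev.U ℝ (n : ℤ))).continuousOn
  have hC0 : 0 ≤ C := (norm_nonneg _).trans (hC 0 (by norm_num))
  refine ⟨2 * (C + 1), fun y h1 h2 => ?_⟩
  have hd : 0 ≤ edgeDecay y := div_nonneg (edge_nonneg y) (by positivity)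
  rcases abs_lt_one_or h1 h2 with hy | hy
  · rw [extU_of_abs_le hy.le]
    calc |(Polynomial.Chebyshev.U ℝ (n : ℤ)).eval y| ≤ C := hC y (abs_le.1 hy.le)
      _ ≤ C * edge y := le_mul_of_one_le_right hC0 (one_le_edge_of_abs_lt hy)
      _ ≤ C * (2 * edgeDecay y) := by
        gcongr
        exact edge_le_two_mul_edgeDecay hy.le
      _ ≤ 2 * (C + 1) * edgeDecay y := by nlinarith
  · have hq := abs_decayRoot_le hy
    have hq1 : |decayRoot y| ≤ 1 := hq.trans ((div_le_one (by linarith)).2 hy.le)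
    rw [extU_of_lt_abs hy, abs_mul, abs_pow]
    calc |decayRoot y| ^ (n + 1) * |extUNegOne y| ≤ 1 / |y| * edge y := by
          gcongr
          · exact (pow_le_of_le_one (abs_nonneg _) hq1 n.succ_ne_zero).trans hq
          · exact abs_extUNegOne_le y
      _ ≤ 2 * edgeDecay y := by
          rw [edgeDecay, one_div_mul_eq_div, mul_div_assoc',
            div_le_div_iff₀ (by linarith) (by positivity)]
          nlinarith [edge_nonneg y]
      _ ≤ 2 * (C + 1) * edgeDecay y := by nlinarith [mul_nonneg hC0 hd]

theorem integrable_extU (n : ℕ) : Integrable (extU n) :=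
  let ⟨_, hC⟩ := exists_abs_extU_le n
  integrable_of_abs_le_edgeDecay (measurable_extU n) hC

theorem integrable_weightedT (n : ℕ) : Integrable (weightedT n) :=
  integrable_of_abs_le_edgeDecay (measurable_weightedT n) fun y _ _ => abs_weightedT_le n y

theorem memLp_extU (n : ℕ) {p : ℝ≥0∞} (h1 : 1 < p) (h2 : p < 2) : MemLp (extU n) p volume := by
  obtain ⟨C, hC⟩ := exists_abs_extU_le n
  refine memLp_of_abs_le_edge (C := |C|) (measurable_extU n) (fun y hy1 hy2 => ?_) h1 h2
  refine (hC y hy1 hy2).trans (mul_le_mul (le_abs_self C) (edgeDecay_le_edge y) ?_ (abs_nonneg C))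
  exact div_nonneg (edge_nonneg y) (by positivity)

theorem memLp_weightedT (n : ℕ) {p : ℝ≥0∞} (h1 : 1 < p) (h2 : p < 2) :
    MemLp (weightedT n) p volume := by
  refine memLp_of_abs_le_edge (C := 2) (measurable_weightedT n) (fun y _ _ => ?_) h1 h2
  linarith [abs_weightedT_le n y, edgeDecay_le_edge y]

theorem integral_weightedT_eq (n : ℕ) : ∫ y, weightedT n y =
    ∫ y, (Polynomial.Chebyshev.T ℝ (n : ℤ)).eval y ∂Polynomial.Chebyshev.measureT := by
  rw [Polynomial.Chebyshev.integral_measureT, intervalIntegral.integral_of_le (by norm_num),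
    integral_Ioc_eq_integral_Ioo, ← integral_indicator measurableSet_Ioo]
  congr 1
  ext y
  by_cases hy : |y| < 1
  · rw [Set.indicator_of_mem (by exact abs_lt.1 hy), weightedT, weight, if_pos hy, one_div,
      mul_comm, Real.sqrt_inv]
  · rw [Set.indicator_of_notMem (by exact fun h => hy (abs_lt.2 h)), weightedT, weight,
      if_neg hy, zero_mul]

theorem integral_weight : ∫ y, weight y = Real.pi := by
  simp only [← weightedT_zero_eq]
  rw [integral_weightedT_eq]
  exact Polynomial.Chebyshev.integral_eval_T_real_measureT_zero

theorem integral_weightedT_succ (n : ℕ) : ∫ y, weightedT (n + 1) y = 0 := by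
  rw [integral_weightedT_eq]
  exact Polynomial.Chebyshev.integral_eval_T_real_measureT_of_ne_zero (by positivity)

theorem sign_eventuallyEq {y : ℝ} (hy : y ≠ 0) : Real.sign =ᶠ[𝓝 y] fun _ => Real.sign y := by
  rcases lt_or_gt_of_ne hy with h | h
  · filter_upwards [Iio_mem_nhds h] with z hz
    rw [Real.sign_of_neg h, Real.sign_of_neg hz]
  · filter_upwards [Ioi_mem_nhds h] with z hz
    rw [Real.sign_of_pos h, Real.sign_of_pos hz]

theorem continuous_extT (n : ℕ) : Continuous (extT n) := by
  refine continuous_if_le continuous_abs continuous_const (Polynomial.continuous _).continuousOn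
    (fun y hy => ?_) fun y hy => ?_
  · have hy : 1 ≤ |y| := hy
    have hsign : ContinuousAt Real.sign y :=
      continuousAt_const.congr (sign_eventuallyEq (by rintro rfl; simp at hy; linarith)).symm
    exact ContinuousAt.continuousWithinAt (by fun_prop)
  · rcases (abs_eq zero_le_one).1 hy with rfl | rfl
    · simp [Real.sign_one]
    · simp [Real.sign_neg, Real.sign_one]

theorem hasDerivAt_decayRoot {y : ℝ} (hy : 1 < |y|) :
    HasDerivAt decayRoot (decayRoot y * extUNegOne y) y := by
  have h0 : y ^ 2 - 1 ≠ 0 := (sub_pos.2 ((one_lt_sq_iff_one_lt_abs y).2 hy)).ne'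
  have h := (hasDerivAt_id y).sub
    (((((hasDerivAt_id y).pow 2).sub_const 1).sqrt h0).const_mul (Real.sign y))
  refine (h.congr_deriv ?_).congr_of_eventuallyEq ?_
  · rw [← one_add_mul_extUNegOne hy, extUNegOne, if_neg (not_le.2 hy)]
    simp only [id_eq, Pi.pow_apply]
    field_simp
    push_cast
    ring
  · filter_upwards [sign_eventuallyEq (y := y) (by rintro rfl; simp at hy; linarith)] with z hz
    simp [decayRoot, hz]

theorem hasDerivAt_extT_succ (n : ℕ) {y : ℝ} (h1 : y ≠ 1) (h2 : y ≠ -1) :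
    HasDerivAt (extT (n + 1)) ((n + 1) * extU n y) y := by
  rcases abs_lt_one_or h1 h2 with hy | hy
  · have h := (Polynomial.Chebyshev.T ℝ ((n + 1 : ℕ) : ℤ)).hasDerivAt y
    rw [Polynomial.Chebyshev.T_derivative_eq_U] at h
    refine (h.congr_deriv ?_).congr_of_eventuallyEq ?_
    · rw [extU_of_abs_le hy.le]
      simp
    · filter_upwards [(isOpen_lt continuous_abs continuous_const).mem_nhds hy] with z hz
        using extT_of_abs_le (le_of_lt hz) _
  · refine (((hasDerivAt_decayRoot hy).pow (n + 1)).congr_deriv ?_).congr_of_eventuallyEq ?_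
    · rw [extU_of_lt_abs hy, Nat.add_sub_cancel]
      push_cast
      ring
    · filter_upwards [(isOpen_lt continuous_const continuous_abs).mem_nhds hy] with z hz
        using extT_of_lt_abs hz _

theorem tendsto_extT_succ (n : ℕ) :
    Tendsto (extT (n + 1)) (Bornology.cobounded ℝ) (𝓝 0) := by
  have hinf := tendsto_norm_cobounded_atTop (E := ℝ)
  refine squeeze_zero_norm' ?_ (tendsto_inv_atTop_zero.comp hinf)
  filter_upwards [hinf.eventually_gt_atTop 1] with y hy
  have hy : 1 < |y| := hy
  have hq := abs_decayRoot_le hy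
  rw [extT_of_lt_abs hy, norm_pow, Function.comp_apply, ← one_div]
  exact (pow_le_of_le_one (norm_nonneg _) (hq.trans ((div_le_one (by linarith)).2 hy.le))
    n.succ_ne_zero).trans hq

/-- The integral vanishes because `extT (n + 1) / (n + 1)` is a continuous antiderivative that tends
to zero at infinity. -/
theorem integral_extU (n : ℕ) : ∫ y, extU n y = 0 := by
  have h := integral_eq_zero_of_hasDerivAt_off_countable (s := {1, -1}) (Set.to_countable _)
    (continuous_extT (n + 1)) (fun y hy => by
      simp only [Set.mem_insert_iff, Set.mem_singleton_iff, not_or] at hy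
      exact hasDerivAt_extT_succ n hy.1 hy.2)
    ((integrable_extU n).const_mul (n + 1 : ℝ)) (tendsto_extT_succ n)
  rw [integral_const_mul] at h
  exact (mul_eq_zero.1 h).resolve_left (by positivity)

/-! ### Hilbert transforms of the Chebyshev functions -/

/-- The commutator of the variable with the Hilbert transform of `extUNegOne`, which is not
integrable, so that `HasHilbertTransformAt.id_mul` does not apply to it. The quotient
`1 / (x - y) - extUNegOne y` has the antiderivative `clampedArcosh y - log |x - y|`, in which the
two logarithmic divergences at infinity cancel. -/
theorem hasHilbertTransformAt_one_sub {x : ℝ} (hx1 : x ≠ 1) (hx2 : x ≠ -1) :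
    HasHilbertTransformAt (fun y => 1 - extUNegOne y * (x - y)) 0 x := by
  have hker : ∀ y, extU 0 y - x * extUNegOne y = 1 - extUNegOne y * (x - y) := by
    intro y
    rw [extU_zero_eq]
    ring
  refine hasHilbertTransformAt_of_hasDerivAt (F := fun y => clampedArcosh y - Real.log (x - y))
    (s := {1, -1}) (L := Real.log 2) (Set.to_countable _) (fun ε hε => ?_) ?_ (fun y hy hs => ?_)
    ?_ ?_
  · have hU : IntegrableOn (fun y => extU 0 y / (x - y)) {y : ℝ | ε < |x - y|} := by
      refine ((integrable_extU 0).norm.const_mul ε⁻¹).integrableOn.mono'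
        ((measurable_extU 0).div (by fun_prop)).aestronglyMeasurable ?_
      filter_upwards [ae_restrict_mem (measurableSet_lt_abs_sub x ε)] with y hy
      have hy : ε < |x - y| := hy
      rw [norm_div, div_eq_inv_mul]
      gcongr
      exact hy.le
    refine IntegrableOn.congr_fun (hU.sub (((hasHilbertTransformAt_extUNegOne hx1 hx2).1 ε
      hε).const_mul x)) (fun y _ => ?_) (measurableSet_lt_abs_sub x ε)
    simp only [Pi.sub_apply]
    rw [← hker y]
    ring
  · refine continuous_clampedArcosh.continuousOn.sub (ContinuousOn.log (by fun_prop) ?_)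
    exact fun y hy => sub_ne_zero.2 (Ne.symm hy)
  · simp only [Set.mem_insert_iff, Set.mem_singleton_iff, not_or] at hs
    have h0 : x - y ≠ 0 := sub_ne_zero.2 hy.symm
    refine ((hasDerivAt_clampedArcosh hs.1 hs.2).sub
      (((hasDerivAt_id y).const_sub x).log h0)).congr_deriv ?_
    simp only [id_eq]
    field_simp
    ring
  · have h := tendsto_clampedArcosh_sub_log.sub (tendsto_log_add_const_sub_log (-x))
    rw [sub_zero] at h
    refine h.congr fun y => ?_
    rw [← Real.log_neg_eq_log (x - y), neg_sub, ← sub_eq_add_neg]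
    ring
  · have h : ContinuousAt (fun ε => clampedArcosh (x - ε) - clampedArcosh (x + ε)) 0 :=
      ((continuous_clampedArcosh.comp (by fun_prop)).sub
        (continuous_clampedArcosh.comp (by fun_prop))).continuousAt
    have h' := h.tendsto.mono_left (nhdsWithin_le_nhds (s := Set.Ioi 0))
    simp only [sub_zero, add_zero, sub_self] at h'
    rw [mul_zero]
    refine h'.congr fun ε => ?_
    rw [sub_sub_cancel, sub_add_cancel_left, Real.log_neg_eq_log]
    ring

/-- The recursion for `extU` starts from `extUNegOne`, whose Hilbert transform is the weight. -/
theorem hasHilbertTransformAt_extU {x : ℝ} (hx1 : x ≠ 1) (hx2 : x ≠ -1) :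
    ∀ n : ℕ, HasHilbertTransformAt (extU n) (weightedT (n + 1) x) x
  | 0 => by
    have h := (hasHilbertTransformAt_one_sub hx1 hx2).add
      ((hasHilbertTransformAt_extUNegOne hx1 hx2).const_mul x)
    rw [zero_add] at h
    convert h using 1
    · ext y
      rw [extU_zero_eq]
      ring
    · rw [weightedT_one_eq]
  | 1 => by
    have h := (hasHilbertTransformAt_extU hx1 hx2 0).chebyshev_step
      (hasHilbertTransformAt_extUNegOne hx1 hx2) (integrable_extU 0) (integral_extU 0)
    rwa [← funext extU_one_eq, ← weightedT_zero_eq, ← weightedT_add_two_eq] at h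
  | n + 2 => by
    have h := (hasHilbertTransformAt_extU hx1 hx2 (n + 1)).chebyshev_step
      (hasHilbertTransformAt_extU hx1 hx2 n) (integrable_extU (n + 1)) (integral_extU (n + 1))
    rwa [← funext (extU_add_two_eq n), ← weightedT_add_two_eq] at h

/-- The recursion for `weightedT` starts from the weight. Its integral `π`, the only one that does
not vanish, accounts for the constant `1` in `extU 0 x = 1 + x * extUNegOne x`. -/
theorem hasHilbertTransformAt_weightedT {x : ℝ} (hx1 : x ≠ 1) (hx2 : x ≠ -1) :
    ∀ n : ℕ, HasHilbertTransformAt (weightedT (n + 1)) (-extU n x) x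
  | 0 => by
    have hi := integrable_weightedT 0
    rw [funext weightedT_zero_eq] at hi
    have h := (hasHilbertTransformAt_weight hx1 hx2).id_mul hi
    rw [← funext weightedT_one_eq, integral_weight, one_div_mul_cancel Real.pi_ne_zero] at h
    convert h using 1
    rw [extU_zero_eq]
    ring
  | 1 => by
    have hw := hasHilbertTransformAt_weight hx1 hx2
    rw [← funext weightedT_zero_eq] at hw
    have h := (hasHilbertTransformAt_weightedT hx1 hx2 0).chebyshev_step hw
      (integrable_weightedT 1) (integral_weightedT_succ 0)
    rw [← funext (weightedT_add_two_eq 0)] at h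
    convert h using 1
    rw [extU_one_eq]
    ring
  | n + 2 => by
    have h := (hasHilbertTransformAt_weightedT hx1 hx2 (n + 1)).chebyshev_step
      (hasHilbertTransformAt_weightedT hx1 hx2 n) (integrable_weightedT (n + 2))
      (integral_weightedT_succ (n + 1))
    rw [← funext (weightedT_add_two_eq (n + 1))] at h
    convert h using 1
    rw [extU_add_two_eq]
    ring

theorem toRef_ne_one {a b x : ℝ} (hab : a < b) (hx : x ≠ b) : toRef a b x ≠ 1 := by
  intro h
  have h0 : b - a ≠ 0 := (sub_pos.2 hab).ne'
  rw [toRef] at h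
  field_simp at h
  exact hx (by linarith)

theorem toRef_ne_neg_one {a b x : ℝ} (hab : a < b) (hx : x ≠ a) : toRef a b x ≠ -1 := by
  intro h
  have h0 : b - a ≠ 0 := (sub_pos.2 hab).ne'
  rw [toRef] at h
  field_simp at h
  exact hx (by linarith)

end

end SumSpace

theorem mainTheorem8 (a b : ℝ) (hab : a < b) (n : ℕ) :
    (∀ p : ℝ≥0∞, 1 < p → p < 2 →
      MemLp (SumSpace.extUOn a b n) p volume ∧
        MemLp (SumSpace.weightedTOn a b (n + 1)) p volume) ∧
    (∀ x : ℝ, x ≠ a → x ≠ b →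
      SumSpace.HasHilbertTransformAt (SumSpace.extUOn a b n)
        (SumSpace.weightedTOn a b (n + 1) x) x) ∧
    (∀ x : ℝ, x ≠ a → x ≠ b →
      SumSpace.HasHilbertTransformAt (SumSpace.weightedTOn a b (n + 1))
        (-SumSpace.extUOn a b n x) x) := by
  refine ⟨fun p h1 h2 => ?_, fun x hxa hxb => ?_, fun x hxa hxb => ?_⟩
  · have h0 : p ≠ 0 := (zero_lt_one.trans h1).ne'
    have ht : p ≠ ⊤ := (h2.trans (by simp)).ne
    exact ⟨SumSpace.memLp_comp_toRef hab h0 ht (SumSpace.measurable_extU n)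
        (SumSpace.memLp_extU n h1 h2),
      SumSpace.memLp_comp_toRef hab h0 ht (SumSpace.measurable_weightedT (n + 1))
        (SumSpace.memLp_weightedT (n + 1) h1 h2)⟩
  · exact (SumSpace.hasHilbertTransformAt_extU (SumSpace.toRef_ne_one hab hxb)
      (SumSpace.toRef_ne_neg_one hab hxa) n).comp_toRef hab
  · exact (SumSpace.hasHilbertTransformAt_weightedT (SumSpace.toRef_ne_one hab hxb)
      (SumSpace.toRef_ne_neg_one hab hxa) n).comp_toRef hab
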